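/- A map $F=(F_1,\dots,F_m):\mathbb{R}^k\to\mathbb{R}^m$ is called polynomial if every component $F_i$ is a real polynomial in $k$ variables, and a set $S\subseteq\mathbb{R}^m$ is called a polynomial image of $\mathbb{R}^k$ if $S=F(\mathbb{R}^k)$ for some polynomial map $F:\mathbb{R}^k\to\mathbb{R}^m$. Put $$\mathrm{p}(S):=\inf\{k\ge 1:\ S \text{ is a polynomial image of } \mathbb{R}^k\}\in\mathbb{N}\cup\{+\infty\},$$ with $\inf\varnothing=+\infty$. Let $n\ge 2$, let $c\in\mathbb{R}^n$, let $r>0$, and let $\overline{B}=\{x\in\mathbb{R}^n:\ \|x-c\|\le r\}$ be the closed Euclidean ball with centre $c$ and radius $r$. Then the complement $\mathbb{R}^n\setminus\overline{B}$ is a polynomial image of $\mathbb{R}^{n+1}$, and $\mathrm{p}(\mathbb{R}^n\setminus\overline{B})=n+1$. (In particular $\mathbb{R}^n\setminus\overline{B}$ is not a polynomial image of $\mathbb{R}^n$.) -/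

import Mathlib

/-- A map `F : ℝᵏ → ℝᵐ` is polynomial if each of its components is given by a real polynomial
in `k` variables. -/
def IsPolynomialMap {k m : ℕ}
    (F : EuclideanSpace ℝ (Fin k) → EuclideanSpace ℝ (Fin m)) : Prop :=
  ∃ f : Fin m → MvPolynomial (Fin k) ℝ,
    ∀ (x : EuclideanSpace ℝ (Fin k)) (i : Fin m), F x i = MvPolynomial.eval (fun j => x j) (f i)

/-- `S ⊆ ℝᵐ` is a polynomial image of `ℝᵏ`: it is exactly the image of some polynomial map
`ℝᵏ → ℝᵐ`. -/
def IsPolynomialImage (k : ℕ) {m : ℕ} (S : Set (EuclideanSpace ℝ (Fin m))) : Prop :=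
  ∃ F : EuclideanSpace ℝ (Fin k) → EuclideanSpace ℝ (Fin m), IsPolynomialMap F ∧ Set.range F = S

/-- The invariant `p(S)`: the infimum of all `k ≥ 1` such that `S` is a polynomial image of `ℝᵏ`;
it is `+∞` (that is `⊤`, the infimum of the empty set in `ℕ∞`) if there is no such `k`. -/
noncomputable def polynomialImageInvariant {m : ℕ} (S : Set (EuclideanSpace ℝ (Fin m))) : ℕ∞ :=
  sInf ((fun k : ℕ => (k : ℕ∞)) '' {k : ℕ | 1 ≤ k ∧ IsPolynomialImage k S})

open Filter Topology

/-! Normalise to the unit ball. Nonexistence in `n` variables: a point of the sphere is a limit of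
values of `F` but not a value, so it is approached only as some coordinate `x i` diverges, and such
limits lie on a fixed hypersurface `A = 0` (`MvPolynomial.exists_eval_eq_zero_of_tendsto`). Near a
suitable `u` on the sphere this hypersurface lies inside the sphere. Restrict `F` to lines in a
direction `j ≠ i` and rescale: a limit is a nonconstant polynomial curve through `u` on `A = 0`,
hence locally in the sphere, which is impossible as such a curve is bounded. Fewer variables reduce
to `n` by adding dummy ones.

Existence in `n + 1` variables: `n - 1` of them give a polynomial vector `V` of norm `(1 + T)²`
whose directions cover the sphere. The other two feed a polynomial `M` such that, over each
direction, `(1 + T)² M` takes exactly the values above one. The map is `V * M`. -/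

/-! ### Limits of polynomial maps at infinity -/

/-- `n + 1` polynomials in `n` variables satisfy a nontrivial polynomial relation; here it is read
as a univariate polynomial relation for the variable `X i`. -/
theorem MvPolynomial.exists_relation_X {n : ℕ} (f : Fin n → MvPolynomial (Fin n) ℝ) (i : Fin n) :
    ∃ Q : Polynomial (MvPolynomial (Fin n) ℝ), Q ≠ 0 ∧ ∀ x : Fin n → ℝ,
      (Q.map (eval fun l => eval x (f l))).eval (x i) = 0 := by
  have hdep : ¬ AlgebraicIndependent ℝ
      (Fin.cons (X i) f : Fin (n + 1) → MvPolynomial (Fin n) ℝ) := by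
    intro h
    have := h.lift_cardinalMk_le_trdeg
    rw [MvPolynomial.trdeg_of_isDomain] at this
    simp only [Cardinal.mk_fin, Cardinal.lift_natCast, Nat.cast_le] at this
    omega
  rw [algebraicIndependent_iff] at hdep
  push Not at hdep
  obtain ⟨p, hp, hp0⟩ := hdep
  refine ⟨finSuccEquiv ℝ n p, by simpa using hp0, fun x => ?_⟩
  rw [← eval_eq_eval_mv_eval']
  have h := congrArg (eval x) hp
  rw [map_zero, aeval_def, ← coe_eval₂Hom, ← RingHom.comp_apply, eval, comp_eval₂Hom] at h
  rw [← h, eval]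
  congr 2
  · ext a; simp
  · funext j
    refine Fin.cases ?_ (fun j => ?_) j <;> simp

/-- The limits of a polynomial map at infinity lie on an algebraic hypersurface. -/
theorem MvPolynomial.exists_eval_eq_zero_of_tendsto {n : ℕ} (f : Fin n → MvPolynomial (Fin n) ℝ) :
    ∃ A : MvPolynomial (Fin n) ℝ, A ≠ 0 ∧ ∀ {ι : Type} (l : Filter ι) [l.NeBot]
      (g : ι → Fin n → ℝ) (i : Fin n) (y : Fin n → ℝ), Tendsto (fun a => |g a i|) l atTop →
      Tendsto (fun a l => eval (g a) (f l)) l (𝓝 y) → eval y A = 0 := by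
  choose Q hQ0 hQ using fun i => exists_relation_X f i
  -- The product covers every coordinate that might diverge.
  refine ⟨∏ i, (Q i).leadingCoeff, Finset.prod_ne_zero_iff.2 fun i _ => by simpa using hQ0 i,
    fun {ι} l _ g i y hg hy => ?_⟩
  rw [map_prod]
  refine Finset.prod_eq_zero (Finset.mem_univ i) ?_
  set q := Q i
  -- The relation divided by the top power of `x i`, as a function of `1 / x i`; at `0` only the
  -- leading coefficient survives.
  let H : (Fin n → ℝ) × ℝ → ℝ := fun p =>
    ∑ j ∈ Finset.range (q.natDegree + 1), eval p.1 (q.coeff j) * p.2 ^ (q.natDegree - j)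
  have hH : Continuous H := by
    refine continuous_finsetSum _ fun j _ => ?_
    exact ((MvPolynomial.continuous_eval _).comp continuous_fst).mul (continuous_snd.pow _)
  have hz : Tendsto (fun a => (g a i)⁻¹) l (𝓝 0) := by
    rw [tendsto_zero_iff_abs_tendsto_zero]
    exact hg.inv_tendsto_atTop.congr fun a => (abs_inv (g a i)).symm
  have hlim : Tendsto (fun a => H (fun l => eval (g a) (f l), (g a i)⁻¹)) l (𝓝 (H (y, 0))) :=
    (hH.tendsto _).comp (hy.prodMk_nhds hz)
  have hzero : ∀ᶠ a in l, H (fun l => eval (g a) (f l), (g a i)⁻¹) = 0 := by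
    filter_upwards [hg.eventually_gt_atTop 0] with a ha
    have hne : g a i ≠ 0 := abs_pos.1 ha
    have h := hQ i (g a)
    rw [Polynomial.eval_map, Polynomial.eval₂_eq_sum_range] at h
    have h2 : H (fun l => eval (g a) (f l), (g a i)⁻¹) = (g a i)⁻¹ ^ q.natDegree *
        ∑ j ∈ Finset.range (q.natDegree + 1),
          eval (fun l => eval (g a) (f l)) (q.coeff j) * g a i ^ j := by
      rw [Finset.mul_sum]
      refine Finset.sum_congr rfl fun j hj => ?_
      have hj' : j ≤ q.natDegree := Nat.lt_succ_iff.1 (Finset.mem_range.1 hj)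
      obtain ⟨d, hd⟩ := Nat.exists_eq_add_of_le hj'
      have hinv : (g a i)⁻¹ ^ j * g a i ^ j = 1 := by rw [← mul_pow, inv_mul_cancel₀ hne, one_pow]
      rw [hd, Nat.add_sub_cancel_left, pow_add]
      linear_combination -(eval (fun l => eval (g a) (f l)) (q.coeff j) * (g a i)⁻¹ ^ d) * hinv
    rw [h2, h, mul_zero]
  have h0 : H (y, 0) = 0 :=
    tendsto_nhds_unique hlim (tendsto_const_nhds.congr' (hzero.mono fun a ha => ha.symm))
  rw [← h0]
  simp only [H]
  rw [Finset.sum_range_succ, Finset.sum_eq_zero]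
  · simp [q]
  · intro j hj
    have : q.natDegree - j ≠ 0 := by have := Finset.mem_range.1 hj; omega
    simp [this]

/-! ### Hypersurfaces and curves near the sphere -/

/-- Restriction of a polynomial to lines: `A (x + s v)` is a polynomial in `s`. -/
theorem MvPolynomial.exists_polynomial_eval_add_smul {n : ℕ} (A : MvPolynomial (Fin n) ℝ)
    (v : Fin n → MvPolynomial (Fin n) ℝ) :
    ∃ P : Polynomial (MvPolynomial (Fin n) ℝ), ∀ (x : Fin n → ℝ) (s : ℝ),
      eval (fun i => x i + s * eval x (v i)) A = (P.map (eval x)).eval s := by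
  refine ⟨aeval (fun i => Polynomial.C (X i) + Polynomial.X * Polynomial.C (v i)) A,
    fun x s => ?_⟩
  induction A using MvPolynomial.induction_on with
  | C a =>
    simp [IsScalarTower.algebraMap_apply ℝ (MvPolynomial (Fin n) ℝ)
      (Polynomial (MvPolynomial (Fin n) ℝ)), MvPolynomial.algebraMap_eq]
  | add p q hp hq => simp [hp, hq]
  | mul_X p i hp =>
    rw [map_mul, map_mul, Polynomial.map_mul, Polynomial.eval_mul, hp]
    simp [mul_comm s]

/-- Near some point of the unit sphere, a given hypersurface is contained in the sphere. -/
theorem MvPolynomial.exists_sphere_eventually {n : ℕ} (A : MvPolynomial (Fin n) ℝ) (hA : A ≠ 0)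
    (hn : 0 < n) :
    ∃ u : Fin n → ℝ, ∑ i, u i ^ 2 = 1 ∧ ∀ᶠ y in 𝓝 u, eval y A = 0 → ∑ i, y i ^ 2 = 1 := by
  classical
  obtain ⟨P, hP⟩ := A.exists_polynomial_eval_add_smul X
  simp only [eval_X] at hP
  let N : (Fin n → ℝ) → ℝ := fun y => √(∑ i, y i ^ 2)
  have hNc : Continuous N := by fun_prop
  have hN1 : ∀ y, N y = 1 ↔ ∑ i, y i ^ 2 = 1 := fun y => by simp [N, Real.sqrt_eq_one]
  have hunit : ∀ y, N y ≠ 0 → ∑ i, ((N y)⁻¹ * y i) ^ 2 = 1 := fun y hy => by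
    have h0 : 0 ≤ ∑ i, y i ^ 2 := Finset.sum_nonneg fun i _ => sq_nonneg _
    simp only [mul_pow, ← Finset.mul_sum]
    rw [← Real.sq_sqrt h0, ← mul_pow]
    simp [N] at hy ⊢
    exact Or.inl (inv_mul_cancel₀ hy)
  have hrad : ∀ y, N y ≠ 0 →
      eval y A = (P.map (eval fun i => (N y)⁻¹ * y i)).eval (N y - 1) := fun y hy => by
    rw [← hP]
    congr 2
    funext i
    field_simp
    ring
  -- The least such `k` is the radial vanishing order of `A` along the sphere; if there were none,
  -- `A` would vanish off the origin.
  have hex : ∃ k, ∃ u : Fin n → ℝ, ∑ i, u i ^ 2 = 1 ∧ eval u (P.coeff k) ≠ 0 := by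
    by_contra! h
    apply hA
    have hz : ∀ y, N y ≠ 0 → eval y A = 0 := fun y hy => by
      have : P.map (eval fun i => (N y)⁻¹ * y i) = 0 := by
        ext k
        simp [h k _ (hunit y hy)]
      rw [hrad y hy, this, Polynomial.eval_zero]
    refine funext_set (fun _ => Set.Ioi (0 : ℝ)) (fun _ => Set.Ioi_infinite 0) fun y hy => ?_
    rw [map_zero]
    refine hz y (Real.sqrt_ne_zero'.2 (Finset.sum_pos (fun i hi => ?_) ⟨⟨0, hn⟩, Finset.mem_univ _⟩))
    have := hy i (Set.mem_univ _)
    exact pow_pos this 2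
  obtain ⟨u, hu, hk⟩ := Nat.find_spec hex
  have hmin : ∀ j < Nat.find hex, ∀ v : Fin n → ℝ, ∑ i, v i ^ 2 = 1 → eval v (P.coeff j) = 0 :=
    fun j hj v hv => by
      have := Nat.find_min hex hj
      push Not at this
      exact this v hv
  set k := Nat.find hex
  refine ⟨u, hu, ?_⟩
  -- `A y = (N y - 1) ^ k * H y` away from the origin, with `H u ≠ 0`.
  let H : (Fin n → ℝ) → ℝ := fun y => ∑ j ∈ Finset.range (P.natDegree + 1),
    eval (fun i => (N y)⁻¹ * y i) (P.coeff (k + j)) * (N y - 1) ^ j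
  have hNu : N u = 1 := (hN1 u).2 hu
  have hHc : ContinuousAt H u := by
    refine tendsto_finsetSum _ fun j _ => ?_
    refine Tendsto.mul ?_ ((hNc.continuousAt.sub continuousAt_const).pow _)
    refine ((MvPolynomial.continuous_eval (P.coeff (k + j))).continuousAt.comp
      (f := fun y : Fin n → ℝ => fun i => (N y)⁻¹ * y i) ?_)
    refine continuousAt_pi.2 fun i => ContinuousAt.mul ?_ (continuous_apply i).continuousAt
    exact hNc.continuousAt.inv₀ (by simp [hNu])
  have hHu : H u ≠ 0 := by
    simp only [H, hNu]
    rw [Finset.sum_range_succ']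
    simpa using hk
  filter_upwards [hHc.eventually_ne hHu, hNc.continuousAt.eventually_ne
    (show N u ≠ 0 by simp [hNu])] with y hHy hNy hAy
  rw [hrad y hNy] at hAy
  have hfac : (P.map (eval fun i => (N y)⁻¹ * y i)).eval (N y - 1) = (N y - 1) ^ k * H y := by
    have hdeg : (P.map (eval fun i => (N y)⁻¹ * y i)).natDegree < k + (P.natDegree + 1) := by
      have := Polynomial.natDegree_map_le (f := eval fun i => (N y)⁻¹ * y i) (p := P)
      omega
    rw [Polynomial.eval_eq_sum_range' hdeg, Finset.sum_range_add, Finset.sum_eq_zero, zero_add,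
      Finset.mul_sum]
    · refine Finset.sum_congr rfl fun j _ => ?_
      rw [Polynomial.coeff_map, pow_add]
      ring
    · intro j hj
      rw [Polynomial.coeff_map, hmin j (Finset.mem_range.1 hj) _ (hunit y hNy), zero_mul]
  rw [hfac] at hAy
  have : N y - 1 = 0 := by_contra fun h => pow_ne_zero k h ((mul_eq_zero.1 hAy).resolve_right hHy)
  exact (hN1 y).1 (sub_eq_zero.1 this)

/-- A polynomial curve contained in the unit sphere near one parameter is constant. -/
theorem Polynomial.natDegree_eq_zero_of_sum_sq_eq_one {ι : Type*} [Fintype ι]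
    (P : ι → Polynomial ℝ) (h : ∀ᶠ t in 𝓝 (0 : ℝ), ∑ i, (P i).eval t ^ 2 = 1) (i : ι) :
    (P i).natDegree = 0 := by
  have hall : ∑ i, P i ^ 2 = 1 := by
    refine Polynomial.eq_of_infinite_eval_eq _ _ ?_
    refine infinite_of_mem_nhds (0 : ℝ) ?_
    filter_upwards [h] with t ht
    simpa [Polynomial.eval_finsetSum] using ht
  have hb : (P i).degree ≤ 0 := by
    refine (Polynomial.isBoundedUnder_abs_atTop_iff _).1 ⟨1, ?_⟩
    rw [eventually_map]
    refine Eventually.of_forall fun t => ?_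
    have h1 := congrArg (Polynomial.eval t) hall
    simp only [Polynomial.eval_finsetSum, Polynomial.eval_pow, Polynomial.eval_one] at h1
    have h2 := Finset.single_le_sum (f := fun i => (P i).eval t ^ 2)
      (fun i _ => sq_nonneg _) (Finset.mem_univ i)
    rw [h1] at h2
    exact abs_le_one_iff_mul_self_le_one.2 (by simpa [sq] using h2)
  exact Polynomial.natDegree_eq_zero_iff_degree_le_zero.2 hb

/-! ### The obstruction in `n` variables -/

/-- A nonzero polynomial with nonnegative coefficients and no constant term takes the value one. -/
theorem exists_sum_mul_pow_eq_one {D : ℕ} (a : Fin D → ℝ) (ha : ∀ d, 0 ≤ a d) (h : ∃ d, a d ≠ 0) :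
    ∃ s : ℝ, 0 ≤ s ∧ ∑ d, a d * s ^ (d.1 + 1) = 1 := by
  obtain ⟨d, hd⟩ := h
  have hd' : 0 < a d := lt_of_le_of_ne (ha d) hd.symm
  set φ : ℝ → ℝ := fun s => ∑ d, a d * s ^ (d.1 + 1)
  have hc : ContinuousOn φ (Set.Icc 0 (1 + (a d)⁻¹)) := by
    apply Continuous.continuousOn; fun_prop
  have h0 : φ 0 = 0 := by simp [φ]
  have hs : 1 ≤ 1 + (a d)⁻¹ := by have := inv_pos.2 hd'; linarith
  have h1 : 1 ≤ φ (1 + (a d)⁻¹) := by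
    calc 1 ≤ a d * (1 + (a d)⁻¹) := by rw [mul_add, mul_inv_cancel₀ hd]; linarith
      _ ≤ a d * (1 + (a d)⁻¹) ^ (d.1 + 1) :=
        mul_le_mul_of_nonneg_left (le_self_pow₀ hs (Nat.succ_ne_zero _)) hd'.le
      _ ≤ φ (1 + (a d)⁻¹) := Finset.single_le_sum (f := fun e => a e * (1 + (a d)⁻¹) ^ (e.1 + 1))
        (fun i _ => mul_nonneg (ha i) (pow_nonneg (by linarith) _)) (Finset.mem_univ d)
  obtain ⟨s, ⟨hs0, -⟩, hs⟩ := intermediate_value_Icc (by linarith) hc ⟨by rw [h0]; norm_num, h1⟩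
  exact ⟨s, hs0, hs⟩

/-- If a polynomial map omits a point in the closure of its image, then some coordinate tends to
infinity along an ultrafilter on which the map tends to that point. -/
theorem exists_ultrafilter_coord_tendsto_atTop {n : ℕ} {F : (Fin n → ℝ) → Fin n → ℝ}
    (hF : Continuous F) {u : Fin n → ℝ} (hu : u ∈ closure (Set.range F)) (hu' : u ∉ Set.range F) :
    ∃ (U : Ultrafilter (Fin n → ℝ)) (i : Fin n), Tendsto F U (𝓝 u) ∧
      Tendsto (fun x : Fin n → ℝ => |x i|) U atTop := by
  have hne : (comap F (𝓝 u)).NeBot := by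
    rw [comap_neBot_iff]
    intro t ht
    obtain ⟨y, hy, x, rfl⟩ := mem_closure_iff_nhds.1 hu t ht
    exact ⟨x, hy⟩
  have hU : Tendsto F (Ultrafilter.of (comap F (𝓝 u))) (𝓝 u) :=
    tendsto_iff_comap.2 (Ultrafilter.of_le _)
  refine ⟨Ultrafilter.of (comap F (𝓝 u)), ?_⟩
  set U := Ultrafilter.of (comap F (𝓝 u))
  -- Otherwise the ultrafilter lives in a compact box, and its limit is a preimage of `u`.
  by_contra! h
  have h' : ∀ i, ∃ R, ∀ᶠ x in (U : Filter (Fin n → ℝ)), |x i| < R := fun i => by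
    have := h i hU
    rw [tendsto_atTop] at this
    push Not at this
    obtain ⟨R, hR⟩ := this
    exact ⟨R, hR⟩
  choose R hR using h'
  have hK : IsCompact (Set.pi Set.univ fun i => Set.Icc (-R i) (R i)) :=
    isCompact_univ_pi fun i => isCompact_Icc
  obtain ⟨x, -, hx⟩ := hK.ultrafilter_le_nhds U (by
    rw [le_principal_iff]
    filter_upwards [eventually_all.2 hR] with x hx i _
    exact abs_le.1 (hx i).le)
  exact hu' ⟨x, tendsto_nhds_unique ((hF.tendsto x).mono_left hx) hU⟩

/-- The exterior of the closed unit ball of `ℝ^n` is not the image of a polynomial map of `ℝ^n`: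
rescaled restrictions to lines going to infinity would produce a nonconstant polynomial curve
inside the sphere. -/
theorem MvPolynomial.range_eval_ne_exterior {n : ℕ} (hn : 2 ≤ n)
    (f : Fin n → MvPolynomial (Fin n) ℝ) :
    Set.range (fun x : Fin n → ℝ => fun l => eval x (f l)) ≠ {y | 1 < ∑ i, y i ^ 2} := by
  intro hrange
  set F : (Fin n → ℝ) → Fin n → ℝ := fun x l => eval x (f l)
  have hFc : Continuous F := continuous_pi fun l => MvPolynomial.continuous_eval _
  have hF1 : ∀ x, 1 < ∑ i, F x i ^ 2 := fun x => by
    have : F x ∈ {y : Fin n → ℝ | 1 < ∑ i, y i ^ 2} := hrange ▸ Set.mem_range_self x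
    exact this
  obtain ⟨A, hA0, hA⟩ := exists_eval_eq_zero_of_tendsto f
  obtain ⟨u, hu1, hu⟩ := exists_sphere_eventually A hA0 (by omega)
  have hucl : u ∈ closure (Set.range F) := by
    rw [hrange]
    have ht : Tendsto (fun t : ℝ => t • u) (𝓝[>] 1) (𝓝 u) := by
      have : Continuous fun t : ℝ => t • u := by fun_prop
      simpa using (this.tendsto 1).mono_left nhdsWithin_le_nhds
    refine mem_closure_of_tendsto ht ?_
    filter_upwards [self_mem_nhdsWithin] with t (ht : 1 < t)
    simp only [Pi.smul_apply, smul_eq_mul, mul_pow, ← Finset.mul_sum, hu1]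
    nlinarith
  have hunot : u ∉ Set.range F := by
    rw [hrange]
    simp [hu1]
  obtain ⟨U, i, hU, hi⟩ := exists_ultrafilter_coord_tendsto_atTop hFc hucl hunot
  -- Moving in direction `j` leaves the divergent coordinate `x i` untouched.
  obtain ⟨j, hj⟩ : ∃ j : Fin n, j ≠ i := by
    have : Nontrivial (Fin n) := Fin.nontrivial_iff_two_le.2 hn
    exact exists_ne i
  choose P hP using fun l => (f l).exists_polynomial_eval_add_smul (fun i =>
    C ((Pi.single j 1 : Fin n → ℝ) i))
  simp only [eval_C] at hP
  let D := Finset.univ.sup fun l => (P l).natDegree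
  let b : (Fin n → ℝ) → Fin D → Fin n → ℝ := fun x d l => eval x ((P l).coeff (d + 1))
  have hline : ∀ x s l, F (fun i => x i + s * (Pi.single j 1 : Fin n → ℝ) i) l =
      F x l + ∑ d, b x d l * s ^ (d.1 + 1) := fun x s l => by
    have key : ∀ s, ((P l).map (eval x)).eval s =
        eval x ((P l).coeff 0) + ∑ d, b x d l * s ^ (d.1 + 1) := fun s => by
      have hdeg : ((P l).map (eval x)).natDegree < D + 1 :=
        Nat.lt_succ_of_le (Polynomial.natDegree_map_le.trans
          (Finset.le_sup (f := fun l => (P l).natDegree) (Finset.mem_univ l)))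
      rw [Polynomial.eval_eq_sum_range' hdeg, Finset.sum_range_succ', add_comm]
      simp only [Polynomial.coeff_map, pow_zero, mul_one, b]
      rw [Finset.sum_range fun d => eval x ((P l).coeff (d + 1)) * s ^ (d + 1)]
    have h0 := hP l x 0
    simp only [zero_mul, add_zero] at h0
    simp only [F]
    rw [hP l x s, h0, key, key]
    simp
  have hUsphere : ∀ᶠ x in (U : Filter (Fin n → ℝ)), eval (F x) A = 0 → ∑ i, F x i ^ 2 = 1 :=
    hU.eventually hu
  -- Were `F` constant on the line, `F x` would itself be a limit at infinity, so on `A = 0`; being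
  -- near `u` it would lie on the sphere.
  have hnonconst : ∀ᶠ x in (U : Filter (Fin n → ℝ)), ∃ d, ∑ l, |b x d l| ≠ 0 := by
    filter_upwards [hUsphere] with x hx
    by_contra! h
    have hb : ∀ d l, b x d l = 0 := fun d l => by
      have := (Finset.sum_eq_zero_iff_of_nonneg fun l _ => abs_nonneg _).1 (h d) l (Finset.mem_univ l)
      exact abs_eq_zero.1 this
    have hconst : ∀ s : ℝ, F (fun i => x i + s * (Pi.single j 1 : Fin n → ℝ) i) = F x := fun s => by
      funext l; simp [hline, hb]
    refine (hF1 x).ne' (hx (hA (atTop : Filter ℝ)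
      (fun s i => x i + s * (Pi.single j 1 : Fin n → ℝ) i) j _ ?_
      (tendsto_const_nhds.congr fun s => (hconst s).symm)))
    simp only [Pi.single_eq_same, mul_one]
    exact tendsto_abs_atTop_atTop.comp (tendsto_atTop_add_const_left _ _ tendsto_id)
  -- Normalising the coefficients keeps them in a compact set and prevents their limit from being
  -- zero.
  have hscale : ∀ x, ∃ s : ℝ, (∃ d, ∑ l, |b x d l| ≠ 0) →
      ∑ d, (∑ l, |b x d l|) * |s| ^ (d.1 + 1) = 1 := fun x => by
    by_cases h : ∃ d, ∑ l, |b x d l| ≠ 0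
    · obtain ⟨s, hs0, hs⟩ := exists_sum_mul_pow_eq_one (fun d => ∑ l, |b x d l|)
        (fun d => Finset.sum_nonneg fun l _ => abs_nonneg _) h
      exact ⟨s, fun _ => by rw [abs_of_nonneg hs0, hs]⟩
    · exact ⟨0, fun h' => absurd h' h⟩
  choose s hs using hscale
  let c : (Fin n → ℝ) → Fin D → Fin n → ℝ := fun x d l => b x d l * s x ^ (d.1 + 1)
  have hcsum : ∀ᶠ x in (U : Filter (Fin n → ℝ)), ∑ d, ∑ l, |c x d l| = 1 := by
    filter_upwards [hnonconst] with x hx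
    simp only [c, abs_mul, abs_pow, ← Finset.sum_mul]
    exact hs x hx
  have hK : IsCompact (Set.pi Set.univ fun _ : Fin D =>
      Set.pi Set.univ fun _ : Fin n => Set.Icc (-1 : ℝ) 1) :=
    isCompact_univ_pi fun _ => isCompact_univ_pi fun _ => isCompact_Icc
  obtain ⟨c', -, hc'⟩ := hK.ultrafilter_le_nhds (U.map c) (by
    rw [le_principal_iff, Ultrafilter.mem_coe, Ultrafilter.mem_map]
    filter_upwards [hcsum] with x hx d _ l _
    rw [Set.mem_Icc, ← abs_le, ← hx]
    exact (Finset.single_le_sum (f := fun l => |c x d l|) (fun l _ => abs_nonneg _)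
      (Finset.mem_univ l)).trans (Finset.single_le_sum (f := fun d => ∑ l, |c x d l|)
      (fun d _ => Finset.sum_nonneg fun l _ => abs_nonneg _) (Finset.mem_univ d)))
  have hct : Tendsto c U (𝓝 c') := hc'
  have hcdl : ∀ d l, Tendsto (fun x => c x d l) U (𝓝 (c' d l)) := fun d l =>
    tendsto_pi_nhds.1 (tendsto_pi_nhds.1 hct d) l
  have hc'sum : ∑ d, ∑ l, |c' d l| = 1 := by
    have h1 : Tendsto (fun x => ∑ d, ∑ l, |c x d l|) U (𝓝 (∑ d, ∑ l, |c' d l|)) :=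
      tendsto_finsetSum _ fun d _ => tendsto_finsetSum _ fun l _ => (hcdl d l).abs
    exact tendsto_nhds_unique h1 (tendsto_const_nhds.congr' (hcsum.mono fun x hx => hx.symm))
  let γ : Fin n → Polynomial ℝ := fun l =>
    Polynomial.C (u l) + ∑ d : Fin D, Polynomial.C (c' d l) * Polynomial.X ^ (d.1 + 1)
  have hγA : ∀ t : ℝ, eval (fun l => (γ l).eval t) A = 0 := fun t => by
    refine hA (U : Filter (Fin n → ℝ))
      (fun x i => x i + t * s x * (Pi.single j 1 : Fin n → ℝ) i) i _ ?_ ?_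
    · simpa [Pi.single_eq_of_ne hj.symm] using hi
    · refine tendsto_pi_nhds.2 fun l => ?_
      have h1 : Tendsto (fun x => F x l + ∑ d : Fin D, c x d l * t ^ (d.1 + 1)) U
          (𝓝 (u l + ∑ d : Fin D, c' d l * t ^ (d.1 + 1))) :=
        (tendsto_pi_nhds.1 hU l).add (tendsto_finsetSum _ fun d _ => (hcdl d l).mul_const _)
      have h2 : (γ l).eval t = u l + ∑ d : Fin D, c' d l * t ^ (d.1 + 1) := by
        simp [γ, Polynomial.eval_finsetSum]
      rw [h2]
      refine h1.congr fun x => ?_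
      rw [show eval (fun i => x i + t * s x * (Pi.single j 1 : Fin n → ℝ) i) (f l) = _ from
        hline x (t * s x) l]
      congr 1
      refine Finset.sum_congr rfl fun d _ => ?_
      simp only [c, mul_pow]
      ring
  have hγ0 : (fun l => (γ l).eval 0) = u := by
    funext l; simp [γ, Polynomial.eval_finsetSum]
  have hγs : ∀ᶠ t in 𝓝 (0 : ℝ), ∑ l, (γ l).eval t ^ 2 = 1 := by
    have hcont : Continuous fun t : ℝ => fun l => (γ l).eval t :=
      continuous_pi fun l => (γ l).continuous
    have := hcont.tendsto 0
    rw [hγ0] at this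
    exact (this.eventually hu).mono fun t ht => ht (hγA t)
  have hdeg := Polynomial.natDegree_eq_zero_of_sum_sq_eq_one γ hγs
  have hzero : ∀ d l, c' d l = 0 := fun d l => by
    have h1 : (γ l).coeff (d.1 + 1) = 0 :=
      Polynomial.coeff_eq_zero_of_natDegree_lt (by rw [hdeg l]; omega)
    simpa [γ, Polynomial.coeff_C, Polynomial.finsetSum_coeff, Polynomial.coeff_X_pow, Fin.val_inj]
      using h1
  simp [hzero] at hc'sum

/-! ### The construction in `n + 1` variables -/

/-- Every unit vector is the direction of a vector
`(4 (1 - |x|²) x, 1 - 6 |x|² + |x|⁴)`, whose norm is `(1 + |x|²)²`. -/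
theorem exists_quadrupled_stereographic {k : ℕ} (hk : 0 < k) (v : Fin k → ℝ) (z : ℝ)
    (h : ∑ i, v i ^ 2 + z ^ 2 = 1) :
    ∃ x : Fin k → ℝ, (∀ i, 4 * (1 - ∑ j, x j ^ 2) * x i = (1 + ∑ j, x j ^ 2) ^ 2 * v i) ∧
      1 - 6 * ∑ j, x j ^ 2 + (∑ j, x j ^ 2) ^ 2 = (1 + ∑ j, x j ^ 2) ^ 2 * z := by
  have hv0 : 0 ≤ ∑ i, v i ^ 2 := Finset.sum_nonneg fun i _ => sq_nonneg _
  set m := √(∑ i, v i ^ 2)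
  have hm : m ^ 2 = ∑ i, v i ^ 2 := Real.sq_sqrt hv0
  obtain ⟨e, he, hve⟩ : ∃ e : Fin k → ℝ, ∑ i, e i ^ 2 = 1 ∧ ∀ i, v i = m * e i := by
    by_cases h0 : m = 0
    · refine ⟨Pi.single ⟨0, hk⟩ 1, ?_, fun i => ?_⟩
      · rw [Finset.sum_eq_single ⟨0, hk⟩] <;> simp +contextual
      · rw [h0, zero_mul]
        rw [h0, zero_pow two_ne_zero, eq_comm, Finset.sum_eq_zero_iff_of_nonneg
          fun i _ => sq_nonneg _] at hm
        exact pow_eq_zero_iff two_ne_zero |>.1 (hm i (Finset.mem_univ i))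
    · refine ⟨fun i => m⁻¹ * v i, ?_, fun i => by field_simp⟩
      simp only [mul_pow, ← Finset.mul_sum]
      rw [← hm]
      field_simp
  have hz : -1 ≤ z ∧ z ≤ 1 := abs_le.1 (abs_le_one_iff_mul_self_le_one.2 (by nlinarith))
  -- With `x = tan θ • e` the polar angle is `4θ`, so `θ ∈ [0, π/4]` already reaches both poles.
  set θ := Real.arccos z / 4 with hθ
  have hα : Real.arccos z = 2 * (2 * θ) := by rw [hθ]; ring
  have hcos : Real.cos (2 * (2 * θ)) = z := by rw [← hα, Real.cos_arccos hz.1 hz.2]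
  have hsin : Real.sin (2 * (2 * θ)) = m := by
    rw [← hα, Real.sin_arccos]
    congr 1
    linarith
  have hc : 0 < Real.cos θ := by
    have := Real.arccos_le_pi z
    have := Real.arccos_nonneg z
    have := Real.pi_pos
    exact Real.cos_pos_of_mem_Ioo ⟨by linarith, by linarith⟩
  have h1 := Real.sin_sq_add_cos_sq θ
  rw [Real.cos_two_mul, Real.cos_two_mul] at hcos
  rw [Real.sin_two_mul, Real.sin_two_mul, Real.cos_two_mul] at hsin
  set C := Real.cos θ
  set S := Real.sin θ
  have hsum : ∑ j, (S / C * e j) ^ 2 = S ^ 2 / C ^ 2 := by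
    simp only [mul_pow, ← Finset.mul_sum, he, mul_one, div_pow]
  have hS : S ^ 2 = 1 - C ^ 2 := by linarith
  have hw : 1 + S ^ 2 / C ^ 2 = 1 / C ^ 2 := by rw [hS]; field_simp; ring
  refine ⟨fun i => S / C * e i, fun i => ?_, ?_⟩
  · rw [hsum, hw, hve, ← hsin, hS]
    field_simp
    ring
  · rw [hsum, hw, ← hcos, hS]
    field_simp
    ring

/-- The value `(1 + τ l²)(1 + l² + (l t - 1)²)` can be any number greater than one. -/
theorem exists_mul_eq_of_one_lt {τ ρ : ℝ} (hτ : 0 ≤ τ) (hρ : 1 < ρ) :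
    ∃ l t : ℝ, (1 + τ * l ^ 2) * (1 + l ^ 2 + (l * t - 1) ^ 2) = ρ := by
  have hc : Continuous fun l : ℝ => (1 + τ * l ^ 2) * (1 + l ^ 2) := by fun_prop
  -- A small `l > 0` leaves room below `ρ`; `t` then makes the last square fill the gap.
  have hev : ∀ᶠ l in nhds (0 : ℝ), (1 + τ * l ^ 2) * (1 + l ^ 2) < ρ :=
    hc.continuousAt.eventually_lt continuousAt_const (by simpa using hρ)
  obtain ⟨l, hl, hl0⟩ := ((hev.filter_mono nhdsWithin_le_nhds).and
    (self_mem_nhdsWithin (s := Set.Ioi (0 : ℝ)))).exists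
  have hl0 : 0 < l := hl0
  have hp : 0 < 1 + τ * l ^ 2 := by positivity
  have hm : 0 ≤ ρ / (1 + τ * l ^ 2) - 1 - l ^ 2 := by
    rw [sub_sub, sub_nonneg, le_div_iff₀ hp]
    linarith
  refine ⟨l, (1 + √(ρ / (1 + τ * l ^ 2) - 1 - l ^ 2)) / l, ?_⟩
  rw [mul_div_cancel₀ _ hl0.ne', add_sub_cancel_left, Real.sq_sqrt hm]
  field_simp
  ring

/-- The exterior of the closed unit ball of `ℝ^(k+1)` is a polynomial image of `ℝ^(k+2)`. -/
theorem MvPolynomial.exists_range_eval_eq_exterior {k : ℕ} (hk : 0 < k) :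
    ∃ f : Fin (k + 1) → MvPolynomial (Fin (k + 2)) ℝ,
      Set.range (fun x : Fin (k + 2) → ℝ => fun l => eval x (f l)) = {y | 1 < ∑ i, y i ^ 2} := by
  let x : Fin k → MvPolynomial (Fin (k + 2)) ℝ := fun i => X i.castSucc.castSucc
  let b : MvPolynomial (Fin (k + 2)) ℝ := X (Fin.last k).castSucc
  let t : MvPolynomial (Fin (k + 2)) ℝ := X (Fin.last (k + 1))
  let T := ∑ i, x i ^ 2
  -- Modulo `(1 + T)²`, `T * ((3 + T) / 2)² = -1`, so `(1 + T)²` divides `1 + T * L²`; the quotient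
  -- is the first factor of `M`. For fixed `T`, varying `b` makes `L` any real number.
  let L := C (1 / 2) * (3 + T) + (1 + T) ^ 2 * b
  let M := (1 + C (1 / 4) * T + T * (3 + T) * b + T * (1 + T) ^ 2 * b ^ 2) *
    (1 + L ^ 2 + (L * t - 1) ^ 2)
  let f : Fin (k + 1) → MvPolynomial (Fin (k + 2)) ℝ :=
    Fin.snoc (fun i => 4 * (1 - T) * x i * M) ((1 - 6 * T + T ^ 2) * M)
  have e4 : ∀ p : Fin (k + 2) → ℝ, eval p (4 : MvPolynomial (Fin (k + 2)) ℝ) = 4 :=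
    fun p => map_ofNat _ 4
  have e3 : ∀ p : Fin (k + 2) → ℝ, eval p (3 : MvPolynomial (Fin (k + 2)) ℝ) = 3 :=
    fun p => map_ofNat _ 3
  have e6 : ∀ p : Fin (k + 2) → ℝ, eval p (6 : MvPolynomial (Fin (k + 2)) ℝ) = 6 :=
    fun p => map_ofNat _ 6
  have hT : ∀ p, eval p T = ∑ i, eval p (x i) ^ 2 := fun p => by simp [T, map_sum]
  have hT0 : ∀ p, 0 ≤ eval p T := fun p => by
    rw [hT]; exact Finset.sum_nonneg fun i _ => sq_nonneg _
  have hL : ∀ p, eval p L = (3 + eval p T) / 2 + (1 + eval p T) ^ 2 * eval p b := fun p => by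
    simp [L, e3]; ring
  have hM : ∀ p, (1 + eval p T) ^ 2 * eval p M = (1 + eval p T * eval p L ^ 2) *
      (1 + eval p L ^ 2 + (eval p L * eval p t - 1) ^ 2) := fun p => by
    have : eval p M = (1 + 1 / 4 * eval p T + eval p T * (3 + eval p T) * eval p b +
        eval p T * (1 + eval p T) ^ 2 * eval p b ^ 2) *
        (1 + eval p L ^ 2 + (eval p L * eval p t - 1) ^ 2) := by
      simp [M, e3]
    rw [this, ← mul_assoc]
    congr 1
    rw [hL]
    ring
  have hfc : ∀ p i, eval p (f (Fin.castSucc i)) = 4 * (1 - eval p T) * eval p (x i) * eval p M :=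
    fun p i => by simp [f, e4]
  have hfl : ∀ p, eval p (f (Fin.last k)) = (1 - 6 * eval p T + eval p T ^ 2) * eval p M :=
    fun p => by simp [f, e6]
  refine ⟨f, Set.Subset.antisymm ?_ fun y hy => ?_⟩
  · rintro _ ⟨p, rfl⟩
    have hsum : ∑ l, eval p (f l) ^ 2 = ((1 + eval p T) ^ 2 * eval p M) ^ 2 := by
      rw [Fin.sum_univ_castSucc]
      simp only [hfc, hfl, mul_pow, ← Finset.sum_mul, ← Finset.mul_sum, ← hT]
      ring
    have h0 := hT0 p
    have hgt : 1 < (1 + eval p T) ^ 2 * eval p M := by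
      rw [hM]
      have h1 : 0 ≤ eval p T * eval p L ^ 2 := by positivity
      -- The squares cannot both vanish: `L = 0` makes the second one equal to one.
      have h2 : 0 < eval p L ^ 2 + (eval p L * eval p t - 1) ^ 2 := by
        by_cases h : eval p L = 0
        · simp [h]
        · positivity
      nlinarith
    show 1 < ∑ l, eval p (f l) ^ 2
    rw [hsum]
    nlinarith
  · have hy : 1 < ∑ i, y i ^ 2 := hy
    set ρ := √(∑ i, y i ^ 2)
    have hρ : ρ ^ 2 = ∑ i, y i ^ 2 := Real.sq_sqrt (by linarith)
    have hρ1 : 1 < ρ := Real.lt_sqrt_of_sq_lt (by simpa using hy)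
    have hρ0 : ρ ≠ 0 := by positivity
    obtain ⟨p, hp, hpl⟩ := exists_quadrupled_stereographic hk
      (fun i : Fin k => y i.castSucc / ρ) (y (Fin.last k) / ρ) (by
        have := hρ
        rw [Fin.sum_univ_castSucc] at this
        simp only [div_pow, ← Finset.sum_div]
        field_simp
        exact this.symm)
    set τ := ∑ j, p j ^ 2
    have hτ : 0 ≤ τ := Finset.sum_nonneg fun i _ => sq_nonneg _
    obtain ⟨l, s, hls⟩ := exists_mul_eq_of_one_lt hτ hρ1
    let q : Fin (k + 2) → ℝ :=
      Fin.snoc (α := fun _ => ℝ) (Fin.snoc (α := fun _ => ℝ) p ((l - (3 + τ) / 2) / (1 + τ) ^ 2)) s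
    have qx : ∀ i, eval q (x i) = p i := fun i => by simp [x, q]
    have qb : eval q b = (l - (3 + τ) / 2) / (1 + τ) ^ 2 := by simp [b, q]
    have qt : eval q t = s := by simp [t, q]
    have qT : eval q T = τ := by rw [hT]; simp only [qx]; rfl
    have hw : (1 + τ) ^ 2 ≠ 0 := by positivity
    have qL : eval q L = l := by
      rw [hL, qT, qb, mul_div_cancel₀ _ hw]; ring
    have qM : (1 + τ) ^ 2 * eval q M = ρ := by
      have := hM q
      rwa [qT, qL, qt, hls] at this
    refine ⟨q, ?_⟩
    funext i
    refine Fin.lastCases ?_ (fun i => ?_) i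
    · simp only [hfl, qT, hpl]
      rw [mul_right_comm, qM, mul_div_cancel₀ _ hρ0]
    · simp only [hfc, qT, qx, hp]
      rw [mul_right_comm, qM, mul_div_cancel₀ _ hρ0]

/-! ### Transfer to arbitrary balls and the value of the invariant -/

theorem EuclideanSpace.mem_compl_closedBall_iff {n : ℕ} {c y : EuclideanSpace ℝ (Fin n)} {r : ℝ}
    (hr : 0 < r) : y ∈ (Metric.closedBall c r)ᶜ ↔ 1 < ∑ i, (r⁻¹ * (y i - c i)) ^ 2 := by
  rw [Set.mem_compl_iff, Metric.mem_closedBall, not_le, dist_eq_norm,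
    ← sq_lt_sq₀ hr.le (norm_nonneg _),
    EuclideanSpace.real_norm_sq_eq]
  simp only [mul_pow, ← Finset.mul_sum, inv_pow, PiLp.sub_apply]
  rw [inv_mul_eq_div, one_lt_div (by positivity)]

/-- Polynomial images may be taken from a space of larger dimension. -/
theorem IsPolynomialImage.mono {k k' m : ℕ} (hkk' : k ≤ k') {S : Set (EuclideanSpace ℝ (Fin m))}
    (h : IsPolynomialImage k S) : IsPolynomialImage k' S := by
  obtain ⟨F, ⟨f, hf⟩, rfl⟩ := h
  refine ⟨fun x => F (WithLp.toLp 2 fun j => x (Fin.castLE hkk' j)),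
    ⟨fun i => MvPolynomial.rename (Fin.castLE hkk') (f i), fun x i => ?_⟩, ?_⟩
  · rw [hf, MvPolynomial.eval_rename]
    rfl
  · refine Set.Subset.antisymm (Set.range_subset_iff.2 fun x => Set.mem_range_self _) ?_
    rintro _ ⟨x, rfl⟩
    refine ⟨WithLp.toLp 2 fun j => if h : j.1 < k then x ⟨j, h⟩ else 0, ?_⟩
    ext j
    simp

theorem isPolynomialImage_compl_closedBall {n : ℕ} (hn : 2 ≤ n) (c : EuclideanSpace ℝ (Fin n))
    {r : ℝ} (hr : 0 < r) : IsPolynomialImage (n + 1) (Metric.closedBall c r)ᶜ := by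
  obtain ⟨k, rfl⟩ : ∃ k, n = k + 1 := ⟨n - 1, by omega⟩
  obtain ⟨f, hf⟩ := MvPolynomial.exists_range_eval_eq_exterior (k := k) (by omega)
  refine ⟨fun x => WithLp.toLp 2 fun i => c i + r * MvPolynomial.eval (fun j => x j) (f i),
    ⟨fun i => MvPolynomial.C (c i) + MvPolynomial.C r * f i, fun x i => by simp⟩, ?_⟩
  ext y
  rw [EuclideanSpace.mem_compl_closedBall_iff hr]
  have key : (fun i => r⁻¹ * (y i - c i)) ∈ Set.range (fun x : Fin (k + 2) → ℝ => fun l =>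
      MvPolynomial.eval x (f l)) ↔ 1 < ∑ i, (r⁻¹ * (y i - c i)) ^ 2 := by rw [hf]; rfl
  rw [← key]
  constructor
  · rintro ⟨x, rfl⟩
    refine ⟨fun j => x j, funext fun l => ?_⟩
    simp [hr.ne']
  · rintro ⟨x, hx⟩
    refine ⟨WithLp.toLp 2 x, ?_⟩
    ext i
    have := congrFun hx i
    simp only at this ⊢
    rw [this]
    field_simp
    ring

theorem not_isPolynomialImage_compl_closedBall {n : ℕ} (hn : 2 ≤ n)
    (c : EuclideanSpace ℝ (Fin n)) {r : ℝ} (hr : 0 < r) :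
    ¬ IsPolynomialImage n (Metric.closedBall c r)ᶜ := by
  rintro ⟨F, ⟨f, hf⟩, hF⟩
  refine MvPolynomial.range_eval_ne_exterior hn
    (fun i => MvPolynomial.C r⁻¹ * (f i - MvPolynomial.C (c i))) ?_
  refine Set.Subset.antisymm ?_ fun y hy => ?_
  · rintro _ ⟨x, rfl⟩
    have : F (WithLp.toLp 2 x) ∈ (Metric.closedBall c r)ᶜ := hF ▸ Set.mem_range_self _
    rw [EuclideanSpace.mem_compl_closedBall_iff hr] at this
    simpa [hf] using this
  · have : WithLp.toLp 2 (fun i => c i + r * y i) ∈ (Metric.closedBall c r)ᶜ := by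
      rw [EuclideanSpace.mem_compl_closedBall_iff hr]
      simpa [hr.ne'] using hy
    rw [← hF] at this
    obtain ⟨x, hx⟩ := this
    refine ⟨fun j => x j, funext fun i => ?_⟩
    have h := congrArg (fun z : EuclideanSpace ℝ (Fin n) => z i) hx
    simp only [hf] at h
    simp [h, hr.ne']

theorem mainTheorem4 (n : ℕ) (hn : 2 ≤ n) (c : EuclideanSpace ℝ (Fin n)) (r : ℝ) (hr : 0 < r) :
    IsPolynomialImage (n + 1) (Metric.closedBall c r)ᶜ ∧
      polynomialImageInvariant (Metric.closedBall c r)ᶜ = ((n + 1 : ℕ) : ℕ∞) := by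
  have h := isPolynomialImage_compl_closedBall hn c hr
  refine ⟨h, le_antisymm (sInf_le ⟨n + 1, ⟨by omega, h⟩, rfl⟩) (le_sInf ?_)⟩
  rintro _ ⟨k, ⟨-, hk⟩, rfl⟩
  by_contra! hlt
  have hkn : k ≤ n := Nat.lt_succ_iff.1 (Nat.cast_lt.1 hlt)
  exact not_isPolynomialImage_compl_closedBall hn c hr (hk.mono hkn)
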